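/- Let $d_L,d_R,T\ge 1$ be integers, $d=d_Ld_R$, let $\mathcal X\subseteq\mathbb R^{d_L\times d_R}$ be convex, $\eta>0$, $\varepsilon\ge 0$, and let $L_1,\dots,L_T:\mathbb R^{d_L\times d_R}\to\mathbb R$ be convex loss functions. One-sided Shampoo with learning rate $\eta$, started at $X_1\in\mathbb R^{d_L\times d_R}$, sets $P_0=\varepsilon I_{d_L}$ and, for $t=1,\dots,T$, $$G_t=\nabla L_t(X_t),\qquad P_t=P_{t-1}+\tfrac1{d_R}G_tG_t^\top,\qquad X_{t+1}=\Pi_{\mathcal X}^{P_t^{1/2}\otimes I_{d_R}}\bigl(X_t-\eta P_t^{-1/2}G_t\bigr),$$ where $L_t$ is assumed differentiable at $X_t$; $P_t^{-1/2}$ is the inverse of $P_t^{1/2}$, to be read as the Moore–Penrose pseudo-inverse if $P_t$ is singular (possible only for $\varepsilon=0$); and $\Pi_{\mathcal X}^{H}(Y)$ denotes any minimizer over $Z\in\mathcal X$ of $\|Y-Z\|_H=\sqrt{\operatorname{vec}(Y-Z)^\top H\operatorname{vec}(Y-Z)}$, with the row-major $\operatorname{vec}$, so that $(A\otimes I_{d_R})\operatorname{vec}(X)=\operatorname{vec}(AX)$.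 (Such minimizers are assumed to exist along the run; for $\varepsilon>0$ and $\mathcal X$ nonempty and closed this is automatic and they are unique.) **Theorem.** For every $X^*\in\mathcal X$, $$\sum_{t=1}^T L_t(X_t)-\sum_{t=1}^T L_t(X^*)\le\Bigl(\frac{D_{\mathrm{op}}^2}{2d_R\eta}+\eta\Bigr)\bigl(G+d\sqrt{\varepsilon}\bigr),$$ where $D_{\mathrm{op}}=\max_{1\le t\le T}\|X_t-X^*\|_{\mathrm{op}}$, $G=\sqrt{d_R}\,\operatorname{Tr}\bigl[\bigl(\sum_{t=1}^T G_tG_t^\top\bigr)^{1/2}\bigr]$ and $\|\cdot\|_{\mathrm{op}}$ is the spectral norm. If moreover $X_1\in\mathcal X$, $\|\mathcal X\|_{\mathrm{op}}:=\sup_{X\in\mathcal X}\|X\|_{\mathrm{op}}<\infty$ and $\eta=\sqrt{2/d_R}\,\|\mathcal X\|_{\mathrm{op}}$, then $$\sum_{t=1}^T L_t(X_t)-\sum_{t=1}^T L_t(X^*)\le 2\sqrt2\,\|\mathcal X\|_{\mathrm{op}}\Bigl(\operatorname{Tr}\Bigl[\Bigl(\sum_{t=1}^T G_tG_t^\top\Bigr)^{1/2}\Bigr]+\frac{d}{\sqrt{d_R}}\sqrt{\varepsilon}\Bigr).$$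 -/

import Mathlib

open scoped Matrix

noncomputable section

namespace OneSidedShampoo

variable {dL dR : ℕ}

open scoped Matrix.Norms.L2Operator in
/-- The operator (spectral) norm of a real matrix, i.e. its norm as a linear map between
Euclidean spaces. -/
def opNorm (A : Matrix (Fin dL) (Fin dR) ℝ) : ℝ := ‖A‖

/-- The norm of a set of matrices, the supremum of the operator norms of its elements
(meaningful when the set is nonempty and bounded). -/
def setOpNorm (𝒳 : Set (Matrix (Fin dL) (Fin dR) ℝ)) : ℝ := sSup (opNorm '' 𝒳)

open scoped MatrixOrder in
/-- The positive semidefinite square root of a positive semidefinite matrix. -/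
def psdSqrt {n : ℕ} (A : Matrix (Fin n) (Fin n) ℝ) : Matrix (Fin n) (Fin n) ℝ := CFC.sqrt A

open scoped MatrixOrder in
/-- The power `-1/2` of a positive semidefinite matrix, by the spectral calculus. It is the inverse
of the square root when `A` is positive definite. When `A` is singular, the eigenvalue `0` is sent
to `0`, so this is the Moore-Penrose pseudo-inverse of the square root. -/
def psdInvSqrt {n : ℕ} (A : Matrix (Fin n) (Fin n) ℝ) : Matrix (Fin n) (Fin n) ℝ :=
  CFC.rpow A (-(1 / 2))

/-- The gradient in matrix form: entry `(i, j)` is the partial derivative of `L` with respect to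
entry `(i, j)` of the argument (used where `L` is differentiable). -/
def matrixGradient (L : Matrix (Fin dL) (Fin dR) ℝ → ℝ) (X : Matrix (Fin dL) (Fin dR) ℝ) :
    Matrix (Fin dL) (Fin dR) ℝ :=
  Matrix.of fun i j => fderiv ℝ L X (Matrix.single i j 1)

/-- Row-major vectorization. With the convention of `Matrix.kroneckerMap`, it satisfies
`(A ⊗ I) vec(X) = vec(A X)`. -/
def rowVec (X : Matrix (Fin dL) (Fin dR) ℝ) : Fin dL × Fin dR → ℝ := fun p => X p.1 p.2

/-- The (semi-)norm `√(xᵀ H x)` of `x = vec(X)`. -/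
def weightedNorm (H : Matrix (Fin dL × Fin dR) (Fin dL × Fin dR) ℝ)
    (X : Matrix (Fin dL) (Fin dR) ℝ) : ℝ :=
  Real.sqrt (rowVec X ⬝ᵥ (H *ᵥ rowVec X))

/-- `Z` is a projection of `Y` onto `𝒳` with respect to the (semi-)norm of `H`, that is, a minimizer
over `Z ∈ 𝒳` of `‖Y - Z‖_H`. -/
def IsProjection (𝒳 : Set (Matrix (Fin dL) (Fin dR) ℝ))
    (H : Matrix (Fin dL × Fin dR) (Fin dL × Fin dR) ℝ) (Y Z : Matrix (Fin dL) (Fin dR) ℝ) : Prop :=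
  Z ∈ 𝒳 ∧ ∀ W ∈ 𝒳, weightedNorm H (Y - Z) ≤ weightedNorm H (Y - W)

/-- The left preconditioners: `L₀ = ε I` and `Lₜ = Lₜ₋₁ + (1 / d_R) Gₜ Gₜᵀ`. -/
def leftPrecond (ε : ℝ) (G : ℕ → Matrix (Fin dL) (Fin dR) ℝ) : ℕ → Matrix (Fin dL) (Fin dL) ℝ
  | 0 => ε • (1 : Matrix (Fin dL) (Fin dL) ℝ)
  | t + 1 => leftPrecond ε G t + (1 / (dR : ℝ)) • (G (t + 1) * (G (t + 1))ᵀ)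

/-- The gradients `Gₜ = ∇Lₜ(Xₜ)` along a sequence of iterates. -/
def gradients (loss : ℕ → Matrix (Fin dL) (Fin dR) ℝ → ℝ) (X : ℕ → Matrix (Fin dL) (Fin dR) ℝ)
    (t : ℕ) : Matrix (Fin dL) (Fin dR) ℝ :=
  matrixGradient (loss t) (X t)

open scoped Kronecker in
/-- `X 1, X 2, …, X (T + 1)` is a run of `T` steps of one-sided Shampoo on the domain `𝒳`, with
learning rate `η` and regularization `ε`, for the losses `loss 1, …, loss T`, started at `X 1`:
`Xₜ₊₁ = Π_𝒳^{Lₜ^{1/2} ⊗ I} (Xₜ - η Lₜ^{-1/2} Gₜ)` for `t = 1, …, T`. -/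
def IsRun (𝒳 : Set (Matrix (Fin dL) (Fin dR) ℝ)) (η ε : ℝ) (T : ℕ)
    (loss : ℕ → Matrix (Fin dL) (Fin dR) ℝ → ℝ) (X : ℕ → Matrix (Fin dL) (Fin dR) ℝ) : Prop :=
  ∀ t ∈ Finset.Icc 1 T,
    IsProjection 𝒳
      (psdSqrt (leftPrecond ε (gradients loss X) t) ⊗ₖ (1 : Matrix (Fin dR) (Fin dR) ℝ))
      (X t - η • (psdInvSqrt (leftPrecond ε (gradients loss X) t) * gradients loss X t))
      (X (t + 1))

/-- `Tr[(∑ₜ Gₜ Gₜᵀ)^{1/2}]`, the sum being over `t = 1, …, T`. -/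
def traceSqrtGram (G : ℕ → Matrix (Fin dL) (Fin dR) ℝ) (T : ℕ) : ℝ :=
  (psdSqrt (∑ t ∈ Finset.Icc 1 T, G t * (G t)ᵀ)).trace

/-- The regret `∑ₜ Lₜ(Xₜ) - ∑ₜ Lₜ(X*)`, the sums being over `t = 1, …, T`. -/
def regret (loss : ℕ → Matrix (Fin dL) (Fin dR) ℝ → ℝ) (X : ℕ → Matrix (Fin dL) (Fin dR) ℝ)
    (Xstar : Matrix (Fin dL) (Fin dR) ℝ) (T : ℕ) : ℝ :=
  ∑ t ∈ Finset.Icc 1 T, loss t (X t) - ∑ t ∈ Finset.Icc 1 T, loss t Xstar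

/-- `D_op`, the maximum over `t = 1, …, T` of `‖Xₜ - X*‖_op`. -/
def maxOpDist (X : ℕ → Matrix (Fin dL) (Fin dR) ℝ) (Xstar : Matrix (Fin dL) (Fin dR) ℝ)
    (T : ℕ) : ℝ :=
  ⨆ t : Finset.Icc 1 T, opNorm (X t - Xstar)

end OneSidedShampoo

end

/-! Write `H t` for the square root of the preconditioner `P t`. Convexity bounds the regret by the
sum of the pairings Tr(Gₜᵀ(Xₜ - X*)). Expanding the weighted square of the unprojected step, and
using that the projection brings it no farther from X*, bounds 2η times a pairing by two terms
(`IsRun.step`).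

The decrease of the `H t`-weighted squared distance to X* telescopes up to the changes of weight.
Since the square root is operator monotone, each change Δ is positive semidefinite and costs at most
D_op² Tr Δ; the total is at most D_op² Tr(H T) (`sum_trace_sub_le`).

The other term is η² Tr(Gₜᵀ Pₜ^{-1/2} Gₜ). As Gₜ Gₜᵀ is d_R times the increment of P,
`trace_psdInvSqrt_mul_sub_le` makes it telescope to at most 2 d_R η² Tr(H T).

Dividing by 2η leaves d_R Tr(H T), which `trace_psdSqrt_add_le` compares with G + d√ε. Singular
preconditioners do no harm: the columns of Gₜ lie in the range of Pₜ, so Pₜ^{1/2} Pₜ^{-1/2} still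
fixes Gₜ. -/

namespace OneSidedShampoo

variable {m n k : ℕ}

/-! ### Square roots and their pseudo-inverses by functional calculus -/

section MatrixOrder
open scoped MatrixOrder

theorem posSemidef_psdSqrt (A : Matrix (Fin n) (Fin n) ℝ) : (psdSqrt A).PosSemidef :=
  Matrix.nonneg_iff_posSemidef.1 (CFC.sqrt_nonneg A)

theorem psdSqrt_mul_self {A : Matrix (Fin n) (Fin n) ℝ} (hA : A.PosSemidef) :
    psdSqrt A * psdSqrt A = A :=
  CFC.sqrt_mul_sqrt_self A hA.nonneg

theorem posSemidef_psdInvSqrt (A : Matrix (Fin n) (Fin n) ℝ) : (psdInvSqrt A).PosSemidef :=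
  Matrix.nonneg_iff_posSemidef.1 (CFC.rpow_nonneg (a := A) (y := -(1 / 2)))

/-- The spectrum is finite, so the functional calculus accepts even x ↦ x^{-1/2}, with its jump at
0. -/
theorem continuousOn_nnreal_spectrum (A : Matrix (Fin n) (Fin n) ℝ) (f : NNReal → NNReal) :
    ContinuousOn f (spectrum NNReal A) := by
  have h : (spectrum NNReal A).Finite := by
    have h1 : (spectrum ℝ A).Finite := Matrix.finite_real_spectrum
    rw [← spectrum.preimage_algebraMap ℝ]
    exact h1.preimage (NNReal.coe_injective.injOn)
  exact h.continuousOn f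

theorem psdSqrt_eq_cfc (A : Matrix (Fin n) (Fin n) ℝ) : psdSqrt A = cfc NNReal.sqrt A :=
  CFC.sqrt_eq_cfc

theorem psdInvSqrt_eq_cfc (A : Matrix (Fin n) (Fin n) ℝ) :
    psdInvSqrt A = cfc (fun x : NNReal => x ^ (-(1 / 2) : ℝ)) A := rfl

theorem nnreal_rpow_neg_half (x : NNReal) : x ^ (-(1 / 2) : ℝ) = (NNReal.sqrt x)⁻¹ := by
  rw [NNReal.rpow_neg, NNReal.sqrt_eq_rpow]

theorem psdSqrt_mul_psdInvSqrt_comm (A : Matrix (Fin n) (Fin n) ℝ) :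
    psdSqrt A * psdInvSqrt A = psdInvSqrt A * psdSqrt A := by
  rw [psdSqrt_eq_cfc, psdInvSqrt_eq_cfc]
  exact (cfc_commute_cfc _ _ A).eq

theorem psdSqrt_mul_psdInvSqrt_mul_psdSqrt (A : Matrix (Fin n) (Fin n) ℝ) :
    psdSqrt A * psdInvSqrt A * psdSqrt A = psdSqrt A := by
  have c := continuousOn_nnreal_spectrum A
  rw [psdSqrt_eq_cfc, psdInvSqrt_eq_cfc, ← cfc_mul _ _ A (c _) (c _), ← cfc_mul _ _ A (c _) (c _)]
  congr 1
  funext x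
  rw [nnreal_rpow_neg_half]
  exact mul_inv_mul_cancel _

end MatrixOrder

/-! ### Order and trace inequalities for positive semidefinite matrices -/

theorem _root_.Matrix.PosSemidef.transpose_eq {A : Matrix (Fin n) (Fin n) ℝ}
    (hA : A.PosSemidef) : Aᵀ = A := by
  simpa [Matrix.conjTranspose_eq_transpose_of_trivial] using hA.isHermitian.eq

theorem _root_.Matrix.PosSemidef.transpose_mul_mul {A : Matrix (Fin n) (Fin n) ℝ}
    (hA : A.PosSemidef) (B : Matrix (Fin n) (Fin m) ℝ) : (Bᵀ * A * B).PosSemidef := by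
  simpa [Matrix.conjTranspose_eq_transpose_of_trivial] using hA.conjTranspose_mul_mul_same B

theorem _root_.Matrix.posSemidef_self_mul_transpose (A : Matrix (Fin n) (Fin m) ℝ) :
    (A * Aᵀ).PosSemidef := by
  simpa [Matrix.conjTranspose_eq_transpose_of_trivial] using
    Matrix.posSemidef_self_mul_conjTranspose A

/-- The trace of a product of positive semidefinite matrices is nonnegative. -/
theorem trace_mul_nonneg {A B : Matrix (Fin n) (Fin n) ℝ} (hA : A.PosSemidef)
    (hB : B.PosSemidef) : 0 ≤ (A * B).trace := by
  have h := (hA.transpose_mul_mul (psdSqrt B)).trace_nonneg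
  rwa [(posSemidef_psdSqrt B).transpose_eq, Matrix.trace_mul_comm, ← Matrix.mul_assoc,
    psdSqrt_mul_self hB, Matrix.trace_mul_comm] at h

/-- A left multiplier annihilating `P` annihilates every factor `B` with `c B Bᵀ ≤ P`. -/
theorem mul_eq_zero_of_posSemidef_sub {P : Matrix (Fin n) (Fin n) ℝ}
    {B : Matrix (Fin n) (Fin m) ℝ} {K : Matrix (Fin k) (Fin n) ℝ} {c : ℝ} (hc : 0 < c)
    (hP : (P - c • (B * Bᵀ)).PosSemidef) (hK : K * P = 0) : K * B = 0 := by
  -- Conjugating by K leaves -c (KB)(KB)ᵀ, whose trace is thus both ≥ 0 and ≤ 0.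
  have h := (hP.transpose_mul_mul Kᵀ).trace_nonneg
  have h2 : (Kᵀ)ᵀ * (P - c • (B * Bᵀ)) * Kᵀ = -(c • ((K * B) * (K * B)ᵀ)) := by
    rw [Matrix.transpose_transpose, Matrix.mul_sub, hK, Matrix.transpose_mul]
    simp [Matrix.mul_assoc]
  rw [h2, Matrix.trace_neg, Matrix.trace_smul, smul_eq_mul] at h
  have h3 := (Matrix.posSemidef_self_mul_transpose (K * B)).trace_nonneg
  have h4 : ((K * B) * (K * B)ᵀ).trace = 0 := by nlinarith
  rw [← Matrix.conjTranspose_eq_transpose_of_trivial] at h4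
  exact Matrix.trace_mul_conjTranspose_self_eq_zero_iff.1 h4

/-- `P^{1/2} P^{-1/2}` fixes every `B` with `c B Bᵀ ≤ P`. -/
theorem psdSqrt_mul_psdInvSqrt_mul {P : Matrix (Fin n) (Fin n) ℝ} (hP : P.PosSemidef)
    {B : Matrix (Fin n) (Fin m) ℝ} {c : ℝ} (hc : 0 < c)
    (h : (P - c • (B * Bᵀ)).PosSemidef) : psdSqrt P * (psdInvSqrt P * B) = B := by
  have h0 : (psdSqrt P * psdInvSqrt P - 1) * P = 0 := by
    rw [Matrix.sub_mul, Matrix.one_mul, sub_eq_zero]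
    nth_rw 3 [← psdSqrt_mul_self hP]
    rw [← Matrix.mul_assoc, psdSqrt_mul_psdInvSqrt_mul_psdSqrt, psdSqrt_mul_self hP]
  have h1 := mul_eq_zero_of_posSemidef_sub hc h h0
  rwa [Matrix.sub_mul, Matrix.one_mul, sub_eq_zero, Matrix.mul_assoc] at h1

/-- The square root is operator monotone. -/
theorem posSemidef_sub_of_sq {A B : Matrix (Fin n) (Fin n) ℝ} (hA : A.PosSemidef)
    (hB : B.PosSemidef) (h : (A * A - B * B).PosSemidef) : (A - B).PosSemidef := by
  have hH : (A - B).IsHermitian := hA.isHermitian.sub hB.isHermitian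
  rw [hH.posSemidef_iff_eigenvalues_nonneg]
  intro i
  by_contra! hlt
  set l := hH.eigenvalues i
  set v : Fin n → ℝ := ⇑(hH.eigenvectorBasis i)
  have hv : (A - B) *ᵥ v = l • v := hH.mulVec_eigenvectorBasis i
  have hv0 : v ≠ 0 := by
    intro h0
    exact hH.eigenvectorBasis.toBasis.ne_zero i (by ext j; exact congrFun h0 j)
  have hT : (A - B)ᵀ = A - B := by
    rw [Matrix.transpose_sub, hA.transpose_eq, hB.transpose_eq]
  have hv' : v ᵥ* (A - B) = l • v := by rw [← Matrix.mulVec_transpose, hT, hv]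
  -- At an eigenvector v of A - B with eigenvalue l < 0, this symmetrization gives vᵀ(A² - B²)v =
  -- l(vᵀAv + vᵀBv). That is negative, because vᵀBv > vᵀAv ≥ 0.
  have e : (2 : ℝ) • (A * A - B * B) = (A - B) * (A + B) + (A + B) * (A - B) := by
    simp only [two_smul]; noncomm_ring
  have ha := hA.dotProduct_mulVec_nonneg v
  have hb := hB.dotProduct_mulVec_nonneg v
  have hq := h.dotProduct_mulVec_nonneg v
  simp only [star_trivial] at ha hb hq
  have e2 : 2 * (v ⬝ᵥ ((A * A - B * B) *ᵥ v)) = 2 * (l * (v ⬝ᵥ (A *ᵥ v) + v ⬝ᵥ (B *ᵥ v))) := by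
    rw [← smul_eq_mul, ← dotProduct_smul, ← Matrix.smul_mulVec, e, Matrix.add_mulVec,
      dotProduct_add, ← Matrix.mulVec_mulVec, ← Matrix.mulVec_mulVec, hv,
      Matrix.dotProduct_mulVec v (A - B), hv', smul_dotProduct, Matrix.mulVec_smul,
      dotProduct_smul, Matrix.add_mulVec, dotProduct_add, smul_eq_mul]
    ring
  have e3 : v ⬝ᵥ (A *ᵥ v) - v ⬝ᵥ (B *ᵥ v) = l * (v ⬝ᵥ v) := by
    rw [← dotProduct_sub, ← Matrix.sub_mulVec, hv, dotProduct_smul, smul_eq_mul]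
  have hvv : 0 < v ⬝ᵥ v := by
    have := Matrix.dotProduct_star_self_pos_iff.2 hv0
    simpa using this
  have := mul_neg_of_neg_of_pos hlt hvv
  nlinarith

theorem posSemidef_psdSqrt_sub {P Q : Matrix (Fin n) (Fin n) ℝ} (hQ : Q.PosSemidef)
    (h : (P - Q).PosSemidef) : (psdSqrt P - psdSqrt Q).PosSemidef := by
  have hP : P.PosSemidef := by simpa using h.add hQ
  refine posSemidef_sub_of_sq (posSemidef_psdSqrt P) (posSemidef_psdSqrt Q) ?_
  rwa [psdSqrt_mul_self hP, psdSqrt_mul_self hQ]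

/-- `Tr(P^{-1/2} (P - Q)) ≤ 2 Tr(P^{1/2} - Q^{1/2})` for `0 ≤ Q ≤ P`. -/
theorem trace_psdInvSqrt_mul_sub_le {P Q : Matrix (Fin n) (Fin n) ℝ} (hQ : Q.PosSemidef)
    (h : (P - Q).PosSemidef) :
    (psdInvSqrt P * (P - Q)).trace ≤ 2 * ((psdSqrt P).trace - (psdSqrt Q).trace) := by
  have hP : P.PosSemidef := by simpa using h.add hQ
  have hAB : psdSqrt P * (psdInvSqrt P * psdSqrt Q) = psdSqrt Q := by
    refine psdSqrt_mul_psdInvSqrt_mul hP one_pos ?_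
    rwa [one_smul, (posSemidef_psdSqrt Q).transpose_eq, psdSqrt_mul_self hQ]
  have h1 : (psdInvSqrt P * P).trace = (psdSqrt P).trace := by
    nth_rw 2 [← psdSqrt_mul_self hP]
    rw [← Matrix.mul_assoc, ← psdSqrt_mul_psdInvSqrt_comm, psdSqrt_mul_psdInvSqrt_mul_psdSqrt]
  -- This nonnegative trace expands to Tr P^{1/2} - 2 Tr Q^{1/2} + Tr(P^{-1/2} Q), which is the
  -- claim rearranged.
  have h2 := ((posSemidef_psdInvSqrt P).transpose_mul_mul (psdSqrt P - psdSqrt Q)).trace_nonneg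
  have e : (psdSqrt P - psdSqrt Q)ᵀ * psdInvSqrt P * (psdSqrt P - psdSqrt Q) =
      psdSqrt P - psdSqrt Q - psdSqrt Q * psdInvSqrt P * psdSqrt P +
        psdSqrt Q * (psdInvSqrt P * psdSqrt Q) := by
    rw [Matrix.transpose_sub, (posSemidef_psdSqrt P).transpose_eq,
      (posSemidef_psdSqrt Q).transpose_eq]
    calc _ = psdSqrt P * psdInvSqrt P * psdSqrt P - psdSqrt P * (psdInvSqrt P * psdSqrt Q)
          - psdSqrt Q * psdInvSqrt P * psdSqrt P + psdSqrt Q * (psdInvSqrt P * psdSqrt Q) := by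
          noncomm_ring
      _ = _ := by rw [psdSqrt_mul_psdInvSqrt_mul_psdSqrt, hAB]
  have h3 : (psdSqrt Q * psdInvSqrt P * psdSqrt P).trace = (psdSqrt Q).trace := by
    rw [Matrix.trace_mul_comm, Matrix.trace_mul_comm, Matrix.mul_assoc,
      ← psdSqrt_mul_psdInvSqrt_comm, Matrix.trace_mul_comm, Matrix.mul_assoc, hAB]
  have h4 : (psdSqrt Q * (psdInvSqrt P * psdSqrt Q)).trace = (psdInvSqrt P * Q).trace := by
    rw [Matrix.trace_mul_comm, Matrix.mul_assoc, psdSqrt_mul_self hQ]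
  rw [e, Matrix.trace_add, Matrix.trace_sub, Matrix.trace_sub, h3, h4] at h2
  rw [Matrix.mul_sub, Matrix.trace_sub, h1]
  linarith

/-- `Tr((ε I + c S)^{1/2}) ≤ n √ε + √c Tr(S^{1/2})`. -/
theorem trace_psdSqrt_add_le {S : Matrix (Fin n) (Fin n) ℝ} (hS : S.PosSemidef) {ε c : ℝ}
    (hε : 0 ≤ ε) (hc : 0 ≤ c) :
    (psdSqrt (ε • (1 : Matrix (Fin n) (Fin n) ℝ) + c • S)).trace ≤
      n * Real.sqrt ε + Real.sqrt c * (psdSqrt S).trace := by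
  have hM : (Real.sqrt ε • (1 : Matrix (Fin n) (Fin n) ℝ) +
      Real.sqrt c • psdSqrt S).PosSemidef :=
    (Matrix.PosSemidef.one.smul (Real.sqrt_nonneg ε)).add
      ((posSemidef_psdSqrt S).smul (Real.sqrt_nonneg c))
  have hP : (ε • (1 : Matrix (Fin n) (Fin n) ℝ) + c • S).PosSemidef :=
    (Matrix.PosSemidef.one.smul hε).add (hS.smul hc)
  -- The square of √ε I + √c S^{1/2} exceeds ε I + c S by the cross term, so monotonicity of the
  -- root applies.
  have h := (posSemidef_sub_of_sq hM (posSemidef_psdSqrt _) (by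
    rw [psdSqrt_mul_self hP]
    have e : (Real.sqrt ε • (1 : Matrix (Fin n) (Fin n) ℝ) + Real.sqrt c • psdSqrt S) *
        (Real.sqrt ε • (1 : Matrix (Fin n) (Fin n) ℝ) + Real.sqrt c • psdSqrt S) -
        (ε • (1 : Matrix (Fin n) (Fin n) ℝ) + c • S) =
        (2 * (Real.sqrt ε * Real.sqrt c)) • psdSqrt S := by
      simp only [Matrix.add_mul, Matrix.mul_add, Matrix.smul_mul, Matrix.mul_smul,
        Matrix.one_mul, Matrix.mul_one, psdSqrt_mul_self hS]
      match_scalars <;> linarith [Real.mul_self_sqrt hε, Real.mul_self_sqrt hc]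
    rw [e]
    exact (posSemidef_psdSqrt S).smul (by positivity))).trace_nonneg
  simp only [Matrix.trace_sub, Matrix.trace_add, Matrix.trace_smul, Matrix.trace_one,
    Fintype.card_fin, smul_eq_mul] at h
  linarith

open scoped Matrix.Norms.L2Operator in
theorem posSemidef_opNorm_sq_sub (D : Matrix (Fin m) (Fin n) ℝ) :
    (opNorm D ^ 2 • (1 : Matrix (Fin m) (Fin m) ℝ) - D * Dᵀ).PosSemidef := by
  have hH : (D * Dᵀ).IsHermitian := (Matrix.posSemidef_self_mul_transpose D).isHermitian
  refine Matrix.PosSemidef.of_dotProduct_mulVec_nonneg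
    ((Matrix.isHermitian_one.smul (star_trivial _)).sub hH) fun x => ?_
  have h := Matrix.l2_opNorm_mulVec Dᵀ (WithLp.toLp 2 x)
  rw [← Matrix.conjTranspose_eq_transpose_of_trivial, Matrix.l2_opNorm_conjTranspose,
    Matrix.conjTranspose_eq_transpose_of_trivial] at h
  have h2 := mul_self_le_mul_self (norm_nonneg _) h
  have e1 : ‖(EuclideanSpace.equiv (Fin n) ℝ).symm (Dᵀ *ᵥ x)‖ *
      ‖(EuclideanSpace.equiv (Fin n) ℝ).symm (Dᵀ *ᵥ x)‖ = (Dᵀ *ᵥ x) ⬝ᵥ (Dᵀ *ᵥ x) := by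
    rw [← sq, EuclideanSpace.real_norm_sq_eq]
    simp [dotProduct, sq]
  have e2 : ‖WithLp.toLp 2 x‖ * ‖WithLp.toLp 2 x‖ = x ⬝ᵥ x := by
    rw [← sq, EuclideanSpace.real_norm_sq_eq]
    simp [dotProduct, sq]
  have e3 : (Dᵀ *ᵥ x) ⬝ᵥ (Dᵀ *ᵥ x) = x ⬝ᵥ ((D * Dᵀ) *ᵥ x) := by
    rw [← Matrix.mulVec_mulVec, Matrix.dotProduct_mulVec x D, ← Matrix.mulVec_transpose]
  rw [mul_mul_mul_comm, e2] at h2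
  rw [star_trivial, Matrix.sub_mulVec, dotProduct_sub, Matrix.smul_mulVec, Matrix.one_mulVec,
    dotProduct_smul, smul_eq_mul, ← e3, ← e1, sub_nonneg, sq]
  exact h2

/-- `Tr(Dᵀ M D) ≤ ‖D‖² Tr M` for positive semidefinite `M`. -/
theorem trace_transpose_mul_mul_le {M : Matrix (Fin m) (Fin m) ℝ} (hM : M.PosSemidef)
    (D : Matrix (Fin m) (Fin n) ℝ) : (Dᵀ * M * D).trace ≤ opNorm D ^ 2 * M.trace := by
  have h := trace_mul_nonneg hM (posSemidef_opNorm_sq_sub D)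
  rw [Matrix.mul_sub, Matrix.trace_sub, Matrix.mul_smul, Matrix.mul_one, Matrix.trace_smul,
    smul_eq_mul] at h
  rw [Matrix.mul_assoc, Matrix.trace_mul_comm, Matrix.mul_assoc]
  linarith

/-! ### Weighted projections and the first-order inequality -/

variable {dL dR : ℕ}

open scoped Kronecker in
theorem weightedNorm_kronecker_one (H : Matrix (Fin dL) (Fin dL) ℝ)
    (X : Matrix (Fin dL) (Fin dR) ℝ) :
    weightedNorm (H ⊗ₖ (1 : Matrix (Fin dR) (Fin dR) ℝ)) X = Real.sqrt (Xᵀ * H * X).trace := by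
  have h : (H ⊗ₖ (1 : Matrix (Fin dR) (Fin dR) ℝ)) *ᵥ rowVec X = rowVec (H * X) := by
    funext p
    simp [Matrix.mulVec, dotProduct, Fintype.sum_prod_type, rowVec, Matrix.mul_apply,
      Matrix.kroneckerMap_apply, Matrix.one_apply]
  rw [weightedNorm, h, Matrix.mul_assoc]
  congr 1
  simp only [dotProduct, rowVec, Matrix.trace, Matrix.diag, Fintype.sum_prod_type,
    Matrix.mul_apply (M := Xᵀ), Matrix.transpose_apply]
  exact Finset.sum_comm

theorem trace_sub_transpose_mul_mul_sub {H : Matrix (Fin dL) (Fin dL) ℝ} (hH : H.PosSemidef)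
    (A B : Matrix (Fin dL) (Fin dR) ℝ) :
    ((A - B)ᵀ * H * (A - B)).trace =
      (Aᵀ * H * A).trace - 2 * (Aᵀ * H * B).trace + (Bᵀ * H * B).trace := by
  have h : (Bᵀ * H * A).trace = (Aᵀ * H * B).trace := by
    rw [← Matrix.trace_transpose]
    simp [Matrix.transpose_mul, hH.transpose_eq, Matrix.mul_assoc]
  simp only [Matrix.transpose_sub, Matrix.sub_mul, Matrix.mul_sub, Matrix.trace_sub, h]
  ring

open scoped Kronecker in
/-- A weighted projection onto a convex set does not increase the distance to points of the set. -/
theorem IsProjection.trace_le {𝒳 : Set (Matrix (Fin dL) (Fin dR) ℝ)} (h𝒳 : Convex ℝ 𝒳)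
    {H : Matrix (Fin dL) (Fin dL) ℝ} (hH : H.PosSemidef) {Y Z W : Matrix (Fin dL) (Fin dR) ℝ}
    (h : IsProjection 𝒳 (H ⊗ₖ (1 : Matrix (Fin dR) (Fin dR) ℝ)) Y Z) (hW : W ∈ 𝒳) :
    ((Z - W)ᵀ * H * (Z - W)).trace ≤ ((Y - W)ᵀ * H * (Y - W)).trace := by
  have hle : ∀ V ∈ 𝒳, ((Y - Z)ᵀ * H * (Y - Z)).trace ≤ ((Y - V)ᵀ * H * (Y - V)).trace := by
    intro V hV
    have := h.2 V hV
    rwa [weightedNorm_kronecker_one, weightedNorm_kronecker_one, Real.sqrt_le_sqrt_iff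
      (hH.transpose_mul_mul (Y - V)).trace_nonneg] at this
  set b := ((Y - Z)ᵀ * H * (W - Z)).trace
  set c := ((W - Z)ᵀ * H * (W - Z)).trace
  have hc : 0 ≤ c := (hH.transpose_mul_mul (W - Z)).trace_nonneg
  have hs : ∀ s : ℝ, 0 ≤ s → s ≤ 1 → 0 ≤ -2 * (s * b) + s * (s * c) := by
    intro s hs0 hs1
    have h1 := hle (Z + s • (W - Z)) (h𝒳.add_smul_sub_mem h.1 hW ⟨hs0, hs1⟩)
    rw [← sub_sub, trace_sub_transpose_mul_mul_sub hH (Y - Z) (s • (W - Z))] at h1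
    simp only [Matrix.transpose_smul, Matrix.smul_mul, Matrix.mul_smul, Matrix.trace_smul,
      smul_eq_mul] at h1
    linarith
  have hb : b ≤ 0 := by
    by_contra! hb
    have hbc : 0 < b + c := by linarith
    -- This s lies in (0, 1] even if c = 0, and s c ≤ b makes the quadratic at most -s b < 0.
    have h1 := hs (b / (b + c)) (by positivity) ((div_le_one hbc).2 (by linarith))
    have h2 : b / (b + c) * c ≤ b := by
      rw [div_mul_eq_mul_div, div_le_iff₀ hbc]
      nlinarith
    have h3 : 0 < b / (b + c) := by positivity
    nlinarith
  have e : Y - W = (Y - Z) - (W - Z) := by abel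
  have e2 : Z - W = -(W - Z) := by abel
  have e3 : ((Z - W)ᵀ * H * (Z - W)).trace = c := by
    rw [e2, Matrix.transpose_neg, Matrix.neg_mul, Matrix.neg_mul, Matrix.mul_neg, neg_neg]
  have h4 := (hH.transpose_mul_mul (Y - Z)).trace_nonneg
  rw [e3, e, trace_sub_transpose_mul_mul_sub hH (Y - Z) (W - Z)]
  linarith

theorem fderiv_eq_trace_matrixGradient (L : Matrix (Fin dL) (Fin dR) ℝ → ℝ)
    (X D : Matrix (Fin dL) (Fin dR) ℝ) : fderiv ℝ L X D = ((matrixGradient L X)ᵀ * D).trace := by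
  conv_lhs => rw [Matrix.matrix_eq_sum_single D]
  have h : ∀ i j, Matrix.single i j (D i j) = D i j • Matrix.single i j (1 : ℝ) := by
    intro i j
    rw [Matrix.smul_single, smul_eq_mul, mul_one]
  simp only [h, map_sum, map_smul, smul_eq_mul, Matrix.trace, Matrix.diag, Matrix.mul_apply,
    Matrix.transpose_apply, matrixGradient, Matrix.of_apply]
  rw [Finset.sum_comm]
  exact Finset.sum_congr rfl fun _ _ => Finset.sum_congr rfl fun _ _ => mul_comm _ _

open scoped Matrix.Norms.Elementwise in
/-- The first-order inequality for convex functions of a matrix. -/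
theorem sub_le_trace_matrixGradient {L : Matrix (Fin dL) (Fin dR) ℝ → ℝ}
    (hL : ConvexOn ℝ Set.univ L) {X : Matrix (Fin dL) (Fin dR) ℝ}
    (hd : DifferentiableAt ℝ L X) (W : Matrix (Fin dL) (Fin dR) ℝ) :
    L X - L W ≤ ((matrixGradient L X)ᵀ * (X - W)).trace := by
  have hline : HasDerivAt (fun s : ℝ => AffineMap.lineMap X W s) (W - X) (0 : ℝ) :=
    AffineMap.hasDerivAt_lineMap
  have hg : HasDerivAt (L ∘ fun s : ℝ => AffineMap.lineMap X W s) (fderiv ℝ L X (W - X))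
      (0 : ℝ) := by
    refine HasFDerivAt.comp_hasDerivAt (0 : ℝ) ?_ hline
    rw [AffineMap.lineMap_apply_zero]
    exact hd.hasFDerivAt
  have hconv : ConvexOn ℝ Set.univ (L ∘ fun s : ℝ => AffineMap.lineMap X W s) :=
    hL.comp_affineMap (AffineMap.lineMap X W)
  have h := hconv.le_slope_of_hasDerivAt (Set.mem_univ 0) (Set.mem_univ 1) one_pos hg
  rw [slope_def_field] at h
  simp only [Function.comp_apply, AffineMap.lineMap_apply_zero, AffineMap.lineMap_apply_one,
    sub_zero, div_one] at h
  rw [← neg_sub W X, Matrix.mul_neg, Matrix.trace_neg, ← fderiv_eq_trace_matrixGradient]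
  linarith

/-! ### Growth of the preconditioners -/

theorem leftPrecond_succ_sub (ε : ℝ) (G : ℕ → Matrix (Fin dL) (Fin dR) ℝ) (t : ℕ) :
    leftPrecond ε G (t + 1) - leftPrecond ε G t =
      (1 / (dR : ℝ)) • (G (t + 1) * (G (t + 1))ᵀ) := by
  rw [leftPrecond, add_sub_cancel_left]

theorem posSemidef_leftPrecond_succ_sub (ε : ℝ) (G : ℕ → Matrix (Fin dL) (Fin dR) ℝ) (t : ℕ) :
    (leftPrecond ε G (t + 1) - leftPrecond ε G t).PosSemidef := by
  rw [leftPrecond_succ_sub]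
  exact (Matrix.posSemidef_self_mul_transpose _).smul (by positivity)

theorem posSemidef_leftPrecond {ε : ℝ} (hε : 0 ≤ ε) (G : ℕ → Matrix (Fin dL) (Fin dR) ℝ) :
    ∀ t, (leftPrecond ε G t).PosSemidef
  | 0 => Matrix.PosSemidef.one.smul hε
  | t + 1 => (posSemidef_leftPrecond hε G t).add
      ((Matrix.posSemidef_self_mul_transpose _).smul (by positivity))

theorem leftPrecond_eq_add_sum (ε : ℝ) (G : ℕ → Matrix (Fin dL) (Fin dR) ℝ) (t : ℕ) :
    leftPrecond ε G t = ε • (1 : Matrix (Fin dL) (Fin dL) ℝ) +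
      (1 / (dR : ℝ)) • ∑ s ∈ Finset.Icc 1 t, G s * (G s)ᵀ := by
  induction t with
  | zero => simp [leftPrecond]
  | succ t ih =>
    rw [leftPrecond, ih, Finset.sum_Icc_succ_top (by omega), smul_add, add_assoc]

/-- `dR Tr(P_T^{1/2}) ≤ √dR Tr((∑ Gₜ Gₜᵀ)^{1/2}) + dL dR √ε`. -/
theorem mul_trace_psdSqrt_leftPrecond_le (hdR : 0 < dR) {ε : ℝ} (hε : 0 ≤ ε)
    (G : ℕ → Matrix (Fin dL) (Fin dR) ℝ) (T : ℕ) :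
    dR * (psdSqrt (leftPrecond ε G T)).trace ≤
      Real.sqrt dR * traceSqrtGram G T + ((dL : ℝ) * (dR : ℝ)) * Real.sqrt ε := by
  have hd : (0 : ℝ) < dR := by exact_mod_cast hdR
  have h := trace_psdSqrt_add_le (S := ∑ s ∈ Finset.Icc 1 T, G s * (G s)ᵀ)
    (Matrix.posSemidef_sum _ fun s _ => Matrix.posSemidef_self_mul_transpose (G s)) hε
    (c := 1 / (dR : ℝ)) (by positivity)
  rw [← leftPrecond_eq_add_sum] at h
  have h2 : (dR : ℝ) * Real.sqrt (1 / (dR : ℝ)) = Real.sqrt dR := by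
    rw [Real.sqrt_div zero_le_one, Real.sqrt_one, mul_one_div, Real.div_sqrt]
  calc _ ≤ (dR : ℝ) * (dL * Real.sqrt ε + Real.sqrt (1 / (dR : ℝ)) * traceSqrtGram G T) :=
        mul_le_mul_of_nonneg_left h hd.le
    _ = _ := by rw [mul_add, ← mul_assoc (dR : ℝ) (Real.sqrt _), h2]; ring

/-! ### One step, telescoping and the regret -/

/-- The progress of a single step towards `W`. -/
theorem IsRun.step {𝒳 : Set (Matrix (Fin dL) (Fin dR) ℝ)} (h𝒳 : Convex ℝ 𝒳) (hdR : 0 < dR)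
    {η ε : ℝ} (hε : 0 ≤ ε) {T : ℕ} {loss : ℕ → Matrix (Fin dL) (Fin dR) ℝ → ℝ}
    {X : ℕ → Matrix (Fin dL) (Fin dR) ℝ} (hrun : IsRun 𝒳 η ε T loss X)
    {W : Matrix (Fin dL) (Fin dR) ℝ} (hW : W ∈ 𝒳) {t : ℕ} (ht : t + 1 ≤ T) :
    2 * η * ((gradients loss X (t + 1))ᵀ * (X (t + 1) - W)).trace ≤
      ((X (t + 1) - W)ᵀ * psdSqrt (leftPrecond ε (gradients loss X) (t + 1)) *
          (X (t + 1) - W)).trace -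
        ((X (t + 2) - W)ᵀ * psdSqrt (leftPrecond ε (gradients loss X) (t + 1)) *
          (X (t + 2) - W)).trace +
      η ^ 2 * (2 * dR * ((psdSqrt (leftPrecond ε (gradients loss X) (t + 1))).trace -
        (psdSqrt (leftPrecond ε (gradients loss X) t)).trace)) := by
  have hd : (0 : ℝ) < dR := by exact_mod_cast hdR
  have hPQ := posSemidef_leftPrecond_succ_sub ε (gradients loss X) t
  have hQ := posSemidef_leftPrecond hε (gradients loss X) t
  have hP := posSemidef_leftPrecond hε (gradients loss X) (t + 1)
  have hG : psdSqrt (leftPrecond ε (gradients loss X) (t + 1)) *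
      (psdInvSqrt (leftPrecond ε (gradients loss X) (t + 1)) * gradients loss X (t + 1)) =
      gradients loss X (t + 1) := by
    refine psdSqrt_mul_psdInvSqrt_mul hP (c := 1 / (dR : ℝ)) (by positivity) ?_
    rwa [← leftPrecond_succ_sub, sub_sub_cancel]
  have hproj := (hrun (t + 1) (Finset.mem_Icc.2 ⟨by omega, ht⟩)).trace_le h𝒳
    (posSemidef_psdSqrt _) hW
  have htr := trace_psdInvSqrt_mul_sub_le hQ hPQ
  rw [leftPrecond_succ_sub, Matrix.mul_smul, Matrix.trace_smul, smul_eq_mul,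
    one_div_mul_eq_div, div_le_iff₀ hd] at htr
  have hsymm : (psdInvSqrt (leftPrecond ε (gradients loss X) (t + 1)))ᵀ = _ :=
    (posSemidef_psdInvSqrt _).transpose_eq
  generalize psdInvSqrt (leftPrecond ε (gradients loss X) (t + 1)) = C at *
  have hH := posSemidef_psdSqrt (leftPrecond ε (gradients loss X) (t + 1))
  generalize psdSqrt (leftPrecond ε (gradients loss X) (t + 1)) = H at *
  generalize gradients loss X (t + 1) = G at *
  have e : X (t + 1) - η • (C * G) - W = (X (t + 1) - W) - η • (C * G) := by abel
  have e1 : ((X (t + 1) - W)ᵀ * H * (η • (C * G))).trace =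
      η * (Gᵀ * (X (t + 1) - W)).trace := by
    rw [Matrix.mul_smul, Matrix.mul_assoc, hG, Matrix.trace_smul, smul_eq_mul,
      ← Matrix.trace_transpose, Matrix.transpose_mul, Matrix.transpose_transpose]
  have e2 : ((η • (C * G))ᵀ * H * (η • (C * G))).trace = η ^ 2 * (C * (G * Gᵀ)).trace := by
    rw [Matrix.mul_smul, Matrix.mul_assoc, hG, Matrix.transpose_smul, Matrix.smul_mul, smul_smul,
      Matrix.trace_smul, smul_eq_mul, Matrix.transpose_mul, hsymm, Matrix.mul_assoc,
      Matrix.trace_mul_comm, Matrix.mul_assoc, sq]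
  rw [e, trace_sub_transpose_mul_mul_sub hH (X (t + 1) - W) (η • (C * G)), e1, e2] at hproj
  have := mul_le_mul_of_nonneg_left htr (sq_nonneg η)
  linarith

/-- Potentials with increasing positive semidefinite weights telescope. -/
theorem sum_trace_sub_le {T : ℕ} (H : ℕ → Matrix (Fin dL) (Fin dL) ℝ)
    (D : ℕ → Matrix (Fin dL) (Fin dR) ℝ) (hH0 : (H 0).PosSemidef)
    (hH : ∀ t, (H (t + 1) - H t).PosSemidef) {M : ℝ} (hM : ∀ t < T, opNorm (D t) ^ 2 ≤ M)
    (hT : 0 < T) :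
    ∑ t ∈ Finset.range T, (((D t)ᵀ * H (t + 1) * D t).trace -
      ((D (t + 1))ᵀ * H (t + 1) * D (t + 1)).trace) ≤ M * (H T).trace := by
  have hb : ∀ {t} {N : Matrix (Fin dL) (Fin dL) ℝ}, t < T → N.PosSemidef →
      ((D t)ᵀ * N * D t).trace ≤ M * N.trace := fun ht hN =>
    (trace_transpose_mul_mul_le hN _).trans
      (mul_le_mul_of_nonneg_right (hM _ ht) hN.trace_nonneg)
  -- Keeping the last potential lets the induction use bounds on `D t` for t < T only; `D T`, which
  -- comes from the iterate T + 1, is not controlled by `maxOpDist`.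
  have key : ∀ k ≤ T, ∑ t ∈ Finset.range k, (((D t)ᵀ * H (t + 1) * D t).trace -
      ((D (t + 1))ᵀ * H (t + 1) * D (t + 1)).trace) ≤
      M * (H k).trace - ((D k)ᵀ * H k * D k).trace := by
    intro k hk
    induction k with
    | zero =>
      rw [Finset.sum_range_zero, sub_nonneg]
      exact hb hT hH0
    | succ k ih =>
      have h1 := ih (by omega)
      have h2 := hb (t := k) (by omega) (hH k)
      rw [Matrix.mul_sub, Matrix.sub_mul, Matrix.trace_sub, Matrix.trace_sub] at h2
      rw [Finset.sum_range_succ]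
      linarith
  have hpsd : ∀ t, (H t).PosSemidef := by
    intro t
    induction t with
    | zero => exact hH0
    | succ t ih => simpa using (hH t).add ih
  have := key T le_rfl
  have := ((hpsd T).transpose_mul_mul (D T)).trace_nonneg
  linarith

theorem opNorm_nonneg (A : Matrix (Fin dL) (Fin dR) ℝ) : 0 ≤ opNorm A := by
  open scoped Matrix.Norms.L2Operator in exact norm_nonneg A

theorem opNorm_sub_le (A B : Matrix (Fin dL) (Fin dR) ℝ) :
    opNorm (A - B) ≤ opNorm A + opNorm B := by
  open scoped Matrix.Norms.L2Operator in exact norm_sub_le A B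

theorem opNorm_le_maxOpDist (X : ℕ → Matrix (Fin dL) (Fin dR) ℝ)
    (W : Matrix (Fin dL) (Fin dR) ℝ) {t T : ℕ} (ht : t ∈ Finset.Icc 1 T) :
    opNorm (X t - W) ≤ maxOpDist X W T :=
  le_ciSup (f := fun t : Finset.Icc 1 T => opNorm (X t - W)) (Set.finite_range _).bddAbove ⟨t, ht⟩

/-- The regret bound in terms of the trace of the last preconditioner. -/
theorem IsRun.regret_le {𝒳 : Set (Matrix (Fin dL) (Fin dR) ℝ)} (h𝒳 : Convex ℝ 𝒳) (hdR : 0 < dR)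
    {η ε : ℝ} (hη : 0 < η) (hε : 0 ≤ ε) {T : ℕ} (hT : 0 < T)
    {loss : ℕ → Matrix (Fin dL) (Fin dR) ℝ → ℝ}
    (hconv : ∀ t ∈ Finset.Icc 1 T, ConvexOn ℝ Set.univ (loss t))
    {X : ℕ → Matrix (Fin dL) (Fin dR) ℝ}
    (hdiff : ∀ t ∈ Finset.Icc 1 T, DifferentiableAt ℝ (loss t) (X t))
    (hrun : IsRun 𝒳 η ε T loss X) {W : Matrix (Fin dL) (Fin dR) ℝ} (hW : W ∈ 𝒳) :
    regret loss X W T ≤ (maxOpDist X W T ^ 2 / (2 * (dR : ℝ) * η) + η) *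
      (dR * (psdSqrt (leftPrecond ε (gradients loss X) T)).trace) := by
  have hd : (0 : ℝ) < dR := by exact_mod_cast hdR
  set H := fun t => psdSqrt (leftPrecond ε (gradients loss X) t)
  have hreg : 2 * η * regret loss X W T ≤ ∑ t ∈ Finset.range T,
      ((((X (t + 1) - W)ᵀ * H (t + 1) * (X (t + 1) - W)).trace -
        ((X (t + 2) - W)ᵀ * H (t + 1) * (X (t + 2) - W)).trace) +
      η ^ 2 * (2 * dR * ((H (t + 1)).trace - (H t).trace))) := by
    rw [regret, ← Finset.sum_sub_distrib, Finset.mul_sum, ← Finset.Ico_add_one_right_eq_Icc,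
      Finset.sum_Ico_eq_sum_range, add_tsub_cancel_right]
    refine Finset.sum_le_sum fun t ht => ?_
    have ht' : t + 1 ≤ T := Finset.mem_range.1 ht
    have hmem : t + 1 ∈ Finset.Icc 1 T := Finset.mem_Icc.2 ⟨by omega, ht'⟩
    rw [add_comm 1 t]
    exact (mul_le_mul_of_nonneg_left
      (sub_le_trace_matrixGradient (hconv _ hmem) (hdiff _ hmem) W) (by positivity)).trans
      (hrun.step h𝒳 hdR hε hW ht')
  have htel := sum_trace_sub_le (T := T) H (fun t => X (t + 1) - W) (posSemidef_psdSqrt _)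
    (fun t => posSemidef_psdSqrt_sub (posSemidef_leftPrecond hε _ t)
      (posSemidef_leftPrecond_succ_sub ε _ t)) (M := maxOpDist X W T ^ 2)
    (fun t ht => pow_le_pow_left₀ (opNorm_nonneg _)
      (opNorm_le_maxOpDist X W (Finset.mem_Icc.2 ⟨by omega, by omega⟩)) 2) hT
  rw [Finset.sum_add_distrib, ← Finset.mul_sum, ← Finset.mul_sum,
    Finset.sum_range_sub (fun t => (H t).trace)] at hreg
  have h0 : 0 ≤ (H 0).trace := (posSemidef_psdSqrt _).trace_nonneg
  have h1 : 0 ≤ η ^ 2 * (2 * dR * (H 0).trace) := by positivity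
  have h2 : 2 * η * regret loss X W T ≤
      maxOpDist X W T ^ 2 * (H T).trace + η ^ 2 * (2 * dR * (H T).trace) := by
    linarith
  have h3 : regret loss X W T ≤
      (maxOpDist X W T ^ 2 * (H T).trace + η ^ 2 * (2 * dR * (H T).trace)) / (2 * η) := by
    rw [le_div_iff₀ (by positivity)]
    linarith
  refine h3.trans (le_of_eq ?_)
  change _ = _ * (dR * (H T).trace)
  field_simp

theorem IsRun.mem {𝒳 : Set (Matrix (Fin dL) (Fin dR) ℝ)} {η ε : ℝ} {T : ℕ}
    {loss : ℕ → Matrix (Fin dL) (Fin dR) ℝ → ℝ} {X : ℕ → Matrix (Fin dL) (Fin dR) ℝ}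
    (hrun : IsRun 𝒳 η ε T loss X) (h1 : X 1 ∈ 𝒳) {t : ℕ} (ht : t ∈ Finset.Icc 1 T) :
    X t ∈ 𝒳 := by
  obtain ⟨ht1, htT⟩ := Finset.mem_Icc.1 ht
  obtain rfl | h := ht1.eq_or_lt
  · exact h1
  · obtain ⟨s, rfl⟩ := Nat.exists_eq_add_of_lt h
    rw [add_comm 1 s]
    exact (hrun (s + 1) (Finset.mem_Icc.2 ⟨by omega, by omega⟩)).1

theorem maxOpDist_le {𝒳 : Set (Matrix (Fin dL) (Fin dR) ℝ)} (hb : BddAbove (opNorm '' 𝒳))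
    {T : ℕ} (hT : 0 < T) {X : ℕ → Matrix (Fin dL) (Fin dR) ℝ}
    (hX : ∀ t ∈ Finset.Icc 1 T, X t ∈ 𝒳) {W : Matrix (Fin dL) (Fin dR) ℝ} (hW : W ∈ 𝒳) :
    maxOpDist X W T ≤ 2 * setOpNorm 𝒳 := by
  have hle : ∀ A ∈ 𝒳, opNorm A ≤ setOpNorm 𝒳 := fun A hA =>
    le_csSup hb (Set.mem_image_of_mem _ hA)
  have : Nonempty (Finset.Icc 1 T) := ⟨⟨1, Finset.mem_Icc.2 ⟨le_rfl, hT⟩⟩⟩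
  refine ciSup_le fun t => (opNorm_sub_le _ _).trans ?_
  rw [two_mul]
  exact add_le_add (hle _ (hX t t.2)) (hle _ hW)

theorem maxOpDist_nonneg (X : ℕ → Matrix (Fin dL) (Fin dR) ℝ)
    (W : Matrix (Fin dL) (Fin dR) ℝ) (T : ℕ) : 0 ≤ maxOpDist X W T :=
  Real.iSup_nonneg fun _ => opNorm_nonneg _

theorem traceSqrtGram_nonneg (G : ℕ → Matrix (Fin dL) (Fin dR) ℝ) (T : ℕ) :
    0 ≤ traceSqrtGram G T :=
  (posSemidef_psdSqrt _).trace_nonneg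

end OneSidedShampoo

/-! ### The two bounds -/

theorem mainTheorem5 {dL dR T : ℕ} (hdL : 0 < dL) (hdR : 0 < dR) (hT : 0 < T)
    (𝒳 : Set (Matrix (Fin dL) (Fin dR) ℝ)) (h𝒳 : Convex ℝ 𝒳)
    (η ε : ℝ) (hη : 0 < η) (hε : 0 ≤ ε)
    (loss : ℕ → Matrix (Fin dL) (Fin dR) ℝ → ℝ)
    (hconv : ∀ t ∈ Finset.Icc 1 T, ConvexOn ℝ Set.univ (loss t))
    (X : ℕ → Matrix (Fin dL) (Fin dR) ℝ)
    (hdiff : ∀ t ∈ Finset.Icc 1 T, DifferentiableAt ℝ (loss t) (X t))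
    (hrun : OneSidedShampoo.IsRun 𝒳 η ε T loss X)
    (Xstar : Matrix (Fin dL) (Fin dR) ℝ) (hXstar : Xstar ∈ 𝒳) :
    (OneSidedShampoo.regret loss X Xstar T ≤
      ((OneSidedShampoo.maxOpDist X Xstar T) ^ 2 / (2 * (dR : ℝ) * η) + η) *
        (Real.sqrt dR *
            OneSidedShampoo.traceSqrtGram (OneSidedShampoo.gradients loss X) T +
          ((dL : ℝ) * (dR : ℝ)) * Real.sqrt ε)) ∧
    (BddAbove (OneSidedShampoo.opNorm '' 𝒳) →
      X 1 ∈ 𝒳 →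
      η = Real.sqrt (2 / (dR : ℝ)) * OneSidedShampoo.setOpNorm 𝒳 →
      OneSidedShampoo.regret loss X Xstar T ≤
        2 * Real.sqrt 2 * OneSidedShampoo.setOpNorm 𝒳 *
          (OneSidedShampoo.traceSqrtGram (OneSidedShampoo.gradients loss X) T +
            ((dL : ℝ) * (dR : ℝ)) / Real.sqrt dR * Real.sqrt ε)) := by
  have hd : (0 : ℝ) < dR := by exact_mod_cast hdR
  have hfirst := (hrun.regret_le h𝒳 hdR hη hε hT hconv hdiff hXstar).trans
    (mul_le_mul_of_nonneg_left
      (OneSidedShampoo.mul_trace_psdSqrt_leftPrecond_le hdR hε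
        (OneSidedShampoo.gradients loss X) T) (by positivity))
  refine ⟨hfirst, fun hb h1 hηN => hfirst.trans ?_⟩
  have hD := OneSidedShampoo.maxOpDist_le hb hT (fun t ht => hrun.mem h1 ht) hXstar
  have hD0 := OneSidedShampoo.maxOpDist_nonneg X Xstar T
  have hS0 := OneSidedShampoo.traceSqrtGram_nonneg (OneSidedShampoo.gradients loss X) T
  generalize OneSidedShampoo.maxOpDist X Xstar T = D at *
  generalize OneSidedShampoo.traceSqrtGram (OneSidedShampoo.gradients loss X) T = S at *
  generalize OneSidedShampoo.setOpNorm 𝒳 = N at *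
  have hr : 0 < Real.sqrt dR := Real.sqrt_pos.2 hd
  have hrr : Real.sqrt dR * Real.sqrt dR = dR := Real.mul_self_sqrt hd.le
  have h2 : Real.sqrt 2 * Real.sqrt 2 = 2 := Real.mul_self_sqrt zero_le_two
  have hηr : η * Real.sqrt dR = Real.sqrt 2 * N := by
    rw [hηN, Real.sqrt_div zero_le_two]
    field_simp
  -- The choice of η balances the two terms at the worst case D = 2N: η² d_R = 2N² turns 4N² / (2
  -- d_R η) into η.
  have hcoef : D ^ 2 / (2 * (dR : ℝ) * η) + η ≤ 2 * η := by
    have hsq : η ^ 2 * dR = 2 * N ^ 2 := by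
      calc η ^ 2 * dR = η ^ 2 * (Real.sqrt dR * Real.sqrt dR) := by rw [hrr]
        _ = (η * Real.sqrt dR) * (η * Real.sqrt dR) := by ring
        _ = (Real.sqrt 2 * Real.sqrt 2) * N ^ 2 := by rw [hηr]; ring
        _ = 2 * N ^ 2 := by rw [h2]
    have hDN : D ^ 2 ≤ (2 * N) ^ 2 := pow_le_pow_left₀ hD0 hD 2
    have : D ^ 2 / (2 * (dR : ℝ) * η) ≤ η := by
      rw [div_le_iff₀ (by positivity)]
      nlinarith
    linarith
  calc _ ≤ 2 * η * (Real.sqrt dR * S + ((dL : ℝ) * (dR : ℝ)) * Real.sqrt ε) :=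
        mul_le_mul_of_nonneg_right hcoef (by positivity)
    _ = 2 * (η * Real.sqrt dR) * (S + ((dL : ℝ) * (dR : ℝ)) / Real.sqrt dR * Real.sqrt ε) := by
        field_simp
    _ = _ := by rw [hηr, mul_assoc 2 (Real.sqrt 2) N]
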